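/- Let $\mathcal H\neq 0$ be a finite-dimensional complex Hilbert space, $\mathcal K=\mathcal H\otimes\mathcal H$ (the second factor being the ancilla), and $M\ge 0$ an integer. For $n\ge 0$ let $\mathcal K^{\otimes n}_+\subset\mathcal K^{\otimes n}$ be the totally symmetric subspace and $D_n^+=\dim \mathcal K^{\otimes n}_+$. Let $\rho$ be a state (a positive semidefinite operator of trace one) on $\mathcal H^{\otimes M}$ that is invariant under all permutations of the $M$ factors. Then $\rho$ has a purification in $\mathcal K_+^{\otimes M}$, i.e. there is $|\Phi\rangle\in\mathcal K_+^{\otimes M}$ such that the partial trace of $|\Phi\rangle\langle\Phi|$ over the $M$ ancillae is $\rho$; and for every such $|\Phi\rangle$ the following holds. Let $$\tilde\rho=\int d\Psi\,p(\Psi)\,\rho(\Psi)^{\otimes M},\qquad p(\Psi)=\mathrm{Tr}\bigl[D_M^+\,|\Psi\rangle\langle\Psi|^{\otimes M}\,|\Phi\rangle\langle\Phi|\bigr],$$ where $d\Psi$ is the normalized Haar measure (the unitarily invariant probability measure) on the pure states (unit vectors) $|\Psi\rangle\in\mathcal K$, and $\rho(\Psi)$ is the state on $\mathcal H$ obtained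 from $|\Psi\rangle\langle\Psi|$ by tracing out the ancilla. Then $p$ is a probability density with respect to $d\Psi$, that is, $p(\Psi)\ge 0$ for all $\Psi$ and $\int d\Psi\,p(\Psi)=1$; $\tilde\rho$ is a separable state on $\mathcal H^{\otimes M}$ (a convex combination of product states $\sigma_1\otimes\dots\otimes\sigma_M$); and for every $0\le k\le M$ and every choice of $k$ of the $M$ factors, the reduced states $\rho^{(k)}$ and $\tilde\rho^{(k)}$ on these factors, obtained by the partial trace over the other $M-k$ factors, satisfy $$\bigl\|\rho^{(k)}-\tilde\rho^{(k)}\bigr\|_1\le 4\left(1-\sqrt{\frac{D^+_{M-k}}{D^+_M}}\right),\qquad \|A\|_1=\mathrm{Tr}|A|=\mathrm{Tr}\sqrt{A^\dagger A}.$$ -/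

import Mathlib

/-! Finite-dimensional quantum systems in coordinates.  A single system with orthonormal basis `ι`
has the Hilbert space `EuclideanSpace ℂ ι`; its `n`-fold tensor power has the orthonormal basis
`Fin n → ι`, and the tensor product of two systems has a product of index types as basis.
Operators are matrices in these bases. -/

open scoped ComplexOrder MatrixOrder
open MeasureTheory

noncomputable section

namespace QDeFinetti

/-- A state: a positive semidefinite matrix of trace one. -/
def IsState {α : Type*} [Fintype α] (ρ : Matrix α α ℂ) : Prop :=
  ρ.PosSemidef ∧ ρ.trace = 1

/-- The rank-one operator `|v⟩⟨v|`. -/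
def ketBra {α : Type*} (v : EuclideanSpace ℂ α) : Matrix α α ℂ :=
  Matrix.vecMulVec v.ofLp (star v.ofLp)

/-- The product operator `⨂ i, A i`. -/
def tensorProd {P ι : Type*} [Fintype P] (A : P → Matrix ι ι ℂ) : Matrix (P → ι) (P → ι) ℂ :=
  Matrix.of fun x y => ∏ i, A i (x i) (y i)

/-- The tensor power `A^{⊗ n}`. -/
def tensorPow {ι : Type*} (n : ℕ) (A : Matrix ι ι ℂ) : Matrix (Fin n → ι) (Fin n → ι) ℂ :=
  tensorProd fun _ => A

/-- The partial trace over the second factor of a bipartite system. -/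
def traceRight {α β : Type*} [Fintype β] (A : Matrix (α × β) (α × β) ℂ) : Matrix α α ℂ :=
  Matrix.of fun x y => ∑ z, A (x, z) (y, z)

/-- The reduction of an operator on `n` systems to the systems in `S`: the partial trace over the
systems that are not in `S`. -/
def reduced {ι : Type*} [Fintype ι] {n : ℕ} (S : Finset (Fin n))
    (A : Matrix (Fin n → ι) (Fin n → ι) ℂ) : Matrix (S → ι) (S → ι) ℂ :=
  traceRight (A.reindex (Equiv.piEquivPiSubtypeProd (fun i => i ∈ S) fun _ => ι)
    (Equiv.piEquivPiSubtypeProd (fun i => i ∈ S) fun _ => ι))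

/-- The partial trace over all `n` ancillae of an operator on `(H ⊗ H)^{⊗ n}`, where the second
factor of each pair is the ancilla. -/
def traceAncillae {ι : Type*} [Fintype ι] {n : ℕ}
    (A : Matrix (Fin n → ι × ι) (Fin n → ι × ι) ℂ) : Matrix (Fin n → ι) (Fin n → ι) ℂ :=
  traceRight (A.reindex (Equiv.arrowProdEquivProdArrow (Fin n) (fun _ => ι) fun _ => ι)
    (Equiv.arrowProdEquivProdArrow (Fin n) (fun _ => ι) fun _ => ι))

/-- Invariance of an operator under all permutations of the `n` systems. -/
def IsPermInvariant {ι : Type*} {n : ℕ} (ρ : Matrix (Fin n → ι) (Fin n → ι) ℂ) : Prop :=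
  ∀ σ : Equiv.Perm (Fin n), ∀ x y, ρ (x ∘ σ) (y ∘ σ) = ρ x y

/-- The totally symmetric subspace of the `n`-fold tensor power of `ℂ^κ`. -/
def symSubspace (κ : Type*) (n : ℕ) : Submodule ℂ (EuclideanSpace ℂ (Fin n → κ)) where
  carrier := {v | ∀ σ : Equiv.Perm (Fin n), ∀ x, v (x ∘ σ) = v x}
  zero_mem' := by intro σ x; simp
  add_mem' := by
    intro v w hv hw σ x
    simp [hv σ x, hw σ x]
  smul_mem' := by
    intro c v hv σ x
    simp [hv σ x]

/-- The dimension of the totally symmetric subspace. -/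
def symDim (κ : Type*) (n : ℕ) : ℕ := Module.finrank ℂ (symSubspace κ n)

/-- A vector of `(H ⊗ H)^{⊗ n}` purifies `ρ` if tracing out the ancillae gives `ρ`. -/
def Purifies {ι : Type*} [Fintype ι] {n : ℕ} (Φ : EuclideanSpace ℂ (Fin n → ι × ι))
    (ρ : Matrix (Fin n → ι) (Fin n → ι) ℂ) : Prop :=
  traceAncillae (ketBra Φ) = ρ

/-- Full separability: a convex combination of product states. -/
def IsFullySeparable {ι : Type*} [Fintype ι] {n : ℕ}
    (ρ : Matrix (Fin n → ι) (Fin n → ι) ℂ) : Prop :=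
  ρ ∈ convexHull ℝ {A | ∃ σ : Fin n → Matrix ι ι ℂ, (∀ i, IsState (σ i)) ∧ A = tensorProd σ}

/-- The trace norm `Tr |A|`, where `|A| = √(Aᴴ A)`. -/
def traceNorm {α : Type*} [Fintype α] [DecidableEq α] (A : Matrix α α ℂ) : ℝ :=
  (CFC.abs A).trace.re

/-- Pure state vectors: the unit sphere of `ℂ^κ`. -/
abbrev PureState (κ : Type*) [Fintype κ] : Type _ :=
  Metric.sphere (0 : EuclideanSpace ℂ κ) 1

/-- The normalized Haar measure on pure states: the surface measure of the unit sphere, divided by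
its total mass.  It is a unitarily invariant probability measure, as shown below. -/
def haarPure (κ : Type*) [Fintype κ] : Measure (PureState κ) :=
  ((volume : Measure (EuclideanSpace ℂ κ)).toSphere Set.univ)⁻¹ •
    (volume : Measure (EuclideanSpace ℂ κ)).toSphere

instance haarPure_isProbabilityMeasure (κ : Type*) [Fintype κ] [Nonempty κ] :
    IsProbabilityMeasure (haarPure κ) := by
  refine ⟨?_⟩
  have h : (volume : Measure (EuclideanSpace ℂ κ)).toSphere Set.univ ≠ 0 := by
    rw [Ne, Measure.measure_univ_eq_zero]
    exact Measure.toSphere_ne_zero _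
  rw [haarPure, Measure.smul_apply, smul_eq_mul]
  exact ENNReal.inv_mul_cancel h (measure_ne_top _ _)

/-- The action of a unitary on pure states. -/
def unitaryAct {κ : Type*} [Fintype κ] (U : EuclideanSpace ℂ κ ≃ₗᵢ[ℂ] EuclideanSpace ℂ κ)
    (Ψ : PureState κ) : PureState κ :=
  ⟨U Ψ, by simp⟩

theorem haarPure_unitary_invariant {κ : Type*} [Fintype κ]
    (U : EuclideanSpace ℂ κ ≃ₗᵢ[ℂ] EuclideanSpace ℂ κ) :
    MeasurePreserving (unitaryAct U) (haarPure κ) (haarPure κ) := by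
  have hU : MeasurePreserving U :=
    (LinearIsometryEquiv.mk (U.toLinearEquiv.restrictScalars ℝ) U.norm_map).measurePreserving
  have hm : Measurable (unitaryAct U) := by
    refine Measurable.subtype_mk ?_
    exact U.continuous.measurable.comp measurable_subtype_coe
  refine MeasurePreserving.smul_measure (c := _) ⟨hm, ?_⟩
  ext s hs
  rw [Measure.map_apply hm hs, Measure.toSphere_apply' _ (hm hs), Measure.toSphere_apply' _ hs]
  congr 1
  refine Eq.trans ?_ (hU.measure_preimage_equiv (f := U.toHomeomorph.toMeasurableEquiv) _)
  congr 1
  ext v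
  simp only [Set.mem_smul, Set.mem_image, Set.mem_preimage]
  constructor
  · rintro ⟨r, hr, _, ⟨Ψ, hΨ, rfl⟩, rfl⟩
    refine ⟨r, hr, _, ⟨_, hΨ, rfl⟩, ?_⟩
    exact (((U.toLinearEquiv.restrictScalars ℝ).map_smul r (Ψ : EuclideanSpace ℂ κ))).symm
  · rintro ⟨r, hr, _, ⟨Ψ, hΨ, rfl⟩, h⟩
    refine ⟨r, hr, _, ⟨unitaryAct U.symm Ψ, ?_, rfl⟩, ?_⟩
    · have : unitaryAct U (unitaryAct U.symm Ψ) = Ψ := Subtype.ext (by simp [unitaryAct])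
      rw [this]
      exact hΨ
    · apply U.injective
      have h2 := (U.toLinearEquiv.restrictScalars ℝ).map_smul r
        (unitaryAct U.symm Ψ : EuclideanSpace ℂ κ)
      refine Eq.trans h2 (Eq.trans ?_ h)
      change r • U (U.symm Ψ) = _
      rw [U.apply_symm_apply]

/-- The effect density `p(Ψ) = Tr[D |Ψ⟩⟨Ψ|^{⊗ n} |Φ⟩⟨Φ|]`, with `D` the dimension of the totally
symmetric subspace. -/
def density {κ : Type*} [Fintype κ] {n : ℕ} (Φ : EuclideanSpace ℂ (Fin n → κ))
    (Ψ : PureState κ) : ℂ :=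
  (((symDim κ n : ℂ) • tensorPow n (ketBra (Ψ : EuclideanSpace ℂ κ))) * ketBra Φ).trace

/-- The reduced state `ρ(Ψ)` of `|Ψ⟩⟨Ψ|` on the first factor of `H ⊗ H`. -/
def localState {ι : Type*} [Fintype ι] (Ψ : PureState (ι × ι)) : Matrix ι ι ℂ :=
  traceRight (ketBra (Ψ : EuclideanSpace ℂ (ι × ι)))

/-- The mixture `∫ dΨ p(Ψ) ρ(Ψ)^{⊗ n}`; the integral is taken entrywise. -/
def deFinettiState {ι : Type*} [Fintype ι] {n : ℕ}
    (Φ : EuclideanSpace ℂ (Fin n → ι × ι)) : Matrix (Fin n → ι) (Fin n → ι) ℂ :=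
  Matrix.of fun x y =>
    ∫ Ψ, density Φ Ψ * tensorPow n (localState Ψ) x y ∂(haarPure (ι × ι))

end QDeFinetti

end

open QDeFinetti

namespace QDeFinetti

open Matrix Finset

/-! On the symmetric subspace, `D_n ∫ |Ψ⟩⟨Ψ|^{⊗ n} dΨ` is the identity (`sum_haarMoment_mul`,
`moment_mul_symDim`). This is proved directly from unitary invariance and the fact that a symmetric
tensor is a homogeneous polynomial, without Schur's lemma. It gives `∫ p = 1` (`integral_density`).

For the bound, split the systems into the `k` kept ones and the rest, and set `v(Ψ) = ⟨Ψ^{⊗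
(M-k)}|Φ⟩` and `y(Ψ) = ⟨Ψ^{⊗ M}|Φ⟩ Ψ^{⊗ k}`. With ancillae still attached, the two reduced states
are `d₁ ∫ |v⟩⟨v|` and `d₂ ∫ |y⟩⟨y|`, where `d₁ = D_{M-k}` and `d₂ = D_M`. The resolution on all `M`
systems evaluates the cross term: `∫ |y⟩⟨v|` is the first reduced state divided by `d₂`. Hence `w =
√d₁ v - √d₂ y` satisfies `∫ ‖w‖² = 2(1 - √(d₁/d₂))`, and the difference of the states is `2(1 -
√(d₁/d₂))` times the first one minus `∫ |w⟩⟨w|`. Testing with `-1 ≤ Z ≤ 1` bounds each of the two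
terms by `2(1 - √(d₁/d₂))` (`abs_sesq_difference_le`).

The symmetric purification is `√ρ` read as a vector. Separability holds because a barycenter of
product states lies in their compact convex hull (`deFinettiState_mem_convexHull`). -/

/-- The coordinates of the product vector `ψ ⊗ ⋯ ⊗ ψ`. -/
def powVec {P κ : Type*} [Fintype P] (ψ : κ → ℂ) (x : P → κ) : ℂ :=
  ∏ i, ψ (x i)

/-! ### Product vectors and symmetric tensors as polynomials. -/

section PowVec

variable {P κ : Type*} [Fintype P]

theorem powVec_comp_perm (ψ : κ → ℂ) (x : P → κ) (σ : Equiv.Perm P) :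
    powVec ψ (x ∘ σ) = powVec ψ x :=
  Equiv.prod_comp σ fun i => ψ (x i)

theorem star_powVec (ψ : κ → ℂ) (x : P → κ) : star (powVec ψ x) = powVec (star ψ) x := by
  simp [powVec]

theorem powVec_mul (φ ψ : κ → ℂ) (x : P → κ) : powVec (φ * ψ) x = powVec φ x * powVec ψ x := by
  simp [powVec, Finset.prod_mul_distrib]

theorem sum_powVec [DecidableEq P] [Fintype κ] (ψ : κ → ℂ) :
    ∑ x : P → κ, powVec ψ x = (∑ j, ψ j) ^ Fintype.card P := by
  simp only [powVec]
  rw [← Fintype.prod_sum (fun (_ : P) j => ψ j)]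
  simp

theorem sum_powVec_mul [DecidableEq P] [Fintype κ] (φ ψ : κ → ℂ) :
    ∑ x : P → κ, powVec φ x * powVec ψ x = (φ ⬝ᵥ ψ) ^ Fintype.card P := by
  simp_rw [← powVec_mul, sum_powVec]
  rfl

/-- Equal exponents mean fibers of equal size over every value; bijections between the fibers glue
to a permutation. -/
theorem exists_perm_of_sum_single_eq {x y : P → κ}
    (h : ∑ i, Finsupp.single (x i) 1 = ∑ i, Finsupp.single (y i) (1 : ℕ)) :
    ∃ σ : Equiv.Perm P, x = y ∘ σ := by
  classical
  have hc (z : P → κ) (j : κ) : Fintype.card {i // z i = j} =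
      (∑ i, Finsupp.single (z i) (1 : ℕ)) j := by
    rw [Finsupp.finsetSum_apply, Fintype.card_subtype, Finset.card_filter]
    exact Finset.sum_congr rfl fun i _ => by rw [Finsupp.single_apply]
  have e (j : κ) : {i // x i = j} ≃ {i // y i = j} :=
    Fintype.equivOfCardEq (by rw [hc, hc, h])
  exact ⟨Equiv.ofFiberEquiv e, funext fun i => (Equiv.ofFiberEquiv_map e i).symm⟩

/-- A symmetric tensor is determined by the associated homogeneous polynomial. -/
theorem eq_zero_of_forall_sum_powVec_mul [DecidableEq P] [Fintype κ] {F : (P → κ) → ℂ}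
    (hF : ∀ (σ : Equiv.Perm P) x, F (x ∘ σ) = F x)
    (h : ∀ a : κ → ℂ, ∑ x, powVec a x * F x = 0) : F = 0 := by
  classical
  let p : MvPolynomial κ ℂ :=
    ∑ x : P → κ, MvPolynomial.monomial (∑ i, Finsupp.single (x i) 1) (F x)
  have hp : p = 0 := by
    refine MvPolynomial.funext fun a => ?_
    rw [map_zero, ← h a, map_sum]
    refine Finset.sum_congr rfl fun x _ => ?_
    rw [← mul_one (F x), ← MvPolynomial.C_mul_monomial, MvPolynomial.monomial_sum_one, map_mul,
      MvPolynomial.eval_C, map_prod, mul_one, mul_comm, powVec]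
    congr 1
    exact Finset.prod_congr rfl fun i _ => MvPolynomial.eval_X _
  funext x
  -- The tensor entries contributing to this monomial are those on the permutation orbit of `x`, all
  -- equal to `F x`; the coefficient is `F x` times the nonzero orbit size.
  have hx : p.coeff (∑ i, Finsupp.single (x i) 1) = 0 := by rw [hp, MvPolynomial.coeff_zero]
  simp only [p, MvPolynomial.coeff_sum, MvPolynomial.coeff_monomial] at hx
  rw [← Finset.sum_filter, Finset.sum_congr rfl (g := fun _ => F x), Finset.sum_const,
    nsmul_eq_mul, mul_eq_zero] at hx
  · refine hx.resolve_left ?_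
    exact Nat.cast_ne_zero.mpr (Finset.card_pos.mpr ⟨x, by simp⟩).ne'
  · intro y hy
    obtain ⟨σ, rfl⟩ := exists_perm_of_sum_single_eq (Finset.mem_filter.mp hy).2
    exact hF σ x

end PowVec

/-! ### Moments of the Haar measure on the sphere. -/

section Haar

variable {κ : Type*} [Fintype κ]

theorem integrable_haarPure {E : Type*} [NormedAddCommGroup E] [Nonempty κ] {f : PureState κ → E}
    (hf : Continuous f) : Integrable f (haarPure κ) :=
  hf.integrable_of_hasCompactSupport (HasCompactSupport.of_compactSpace f)

theorem integral_comp_unitaryAct {E : Type*} [NormedAddCommGroup E] [NormedSpace ℝ E]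
    {f : PureState κ → E} (hf : Continuous f)
    (U : EuclideanSpace ℂ κ ≃ₗᵢ[ℂ] EuclideanSpace ℂ κ) :
    ∫ Ψ, f (unitaryAct U Ψ) ∂(haarPure κ) = ∫ Ψ, f Ψ ∂(haarPure κ) := by
  have h := haarPure_unitary_invariant U
  rw [← integral_map h.measurable.aemeasurable, h.map_eq]
  exact hf.aestronglyMeasurable

/-- Multiplication of all coordinates but one by a phase. -/
theorem exists_phase [DecidableEq κ] (e : κ) {ω : ℂ} (hω : ‖ω‖ = 1) :
    ∃ U : EuclideanSpace ℂ κ ≃ₗᵢ[ℂ] EuclideanSpace ℂ κ,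
      ∀ v j, (U v).ofLp j = (if j = e then 1 else ω) * v.ofLp j := by
  let L : EuclideanSpace ℂ κ →ₗ[ℂ] EuclideanSpace ℂ κ :=
    { toFun := fun v => WithLp.toLp 2 fun j => (if j = e then 1 else ω) * v.ofLp j
      map_add' := fun v w => by ext j; simp [mul_add]
      map_smul' := fun c v => by ext j; simp [mul_left_comm] }
  let L' : EuclideanSpace ℂ κ →ₗᵢ[ℂ] EuclideanSpace ℂ κ := ⟨L, fun v => by
    simp only [L, EuclideanSpace.norm_eq, LinearMap.coe_mk, AddHom.coe_mk, norm_mul]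
    congr 1
    refine Finset.sum_congr rfl fun j _ => ?_
    split_ifs <;> simp [hω]⟩
  exact ⟨L'.toLinearIsometryEquiv rfl, fun v j => rfl⟩

theorem exists_unitary_single [DecidableEq κ] (e : κ) (a : EuclideanSpace ℂ κ) :
    ∃ U : EuclideanSpace ℂ κ ≃ₗᵢ[ℂ] EuclideanSpace ℂ κ,
      a = (‖a‖ : ℂ) • U (EuclideanSpace.single e 1) := by
  by_cases ha : a = 0
  · exact ⟨LinearIsometryEquiv.refl ℂ _, by simp [ha]⟩
  have hn : ‖((‖a‖ : ℂ)⁻¹ • a)‖ = 1 := by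
    rw [norm_smul, norm_inv, Complex.norm_real, norm_norm,
      inv_mul_cancel₀ (norm_ne_zero_iff.mpr ha)]
  obtain ⟨b, hb⟩ := Orthonormal.exists_orthonormalBasis_extension_of_card_eq (𝕜 := ℂ)
    (E := EuclideanSpace ℂ κ) (ι := κ) (by simp) (v := fun _ => (‖a‖ : ℂ)⁻¹ • a) (s := {e})
    ⟨fun _ => hn, fun i j hij => (hij (Subsingleton.elim _ _)).elim⟩
  refine ⟨b.repr.symm, ?_⟩
  rw [OrthonormalBasis.repr_symm_single, hb e rfl, smul_smul, mul_inv_cancel₀, one_smul]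
  simpa using ha

/-- The moment `∫ |⟨e, Ψ⟩|²ⁿ dΨ` of a unit vector `e`. -/
noncomputable def moment (κ : Type*) [Fintype κ] [Nonempty κ] (n : ℕ) : ℝ :=
  ∫ Ψ : PureState κ, ‖Ψ.1.ofLp (Classical.arbitrary κ)‖ ^ (2 * n) ∂(haarPure κ)

variable [Nonempty κ]

/-- Expand `(b ⬝ᵥ Ψ) ^ n` binomially around the coordinate `e`. Every term containing the other
coordinates vanishes by phase invariance. -/
theorem integral_coord_mul_pow (n : ℕ) (b : κ → ℂ) :
    ∫ Ψ : PureState κ, (b ⬝ᵥ Ψ.1.ofLp) ^ n * star (Ψ.1.ofLp (Classical.arbitrary κ)) ^ n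
      ∂(haarPure κ) = moment κ n * b (Classical.arbitrary κ) ^ n := by
  classical
  set e := Classical.arbitrary κ
  let R : (κ → ℂ) → ℂ := fun ψ => ∑ j ∈ univ.erase e, b j * ψ j
  have hR : ∀ ψ : κ → ℂ, b ⬝ᵥ ψ = R ψ + b e * ψ e := fun ψ =>
    (Finset.sum_erase_add _ _ (mem_univ e)).symm
  have hRc : Continuous fun Ψ : PureState κ => R Ψ.1.ofLp := by fun_prop
  let C : ℕ → PureState κ → ℂ := fun m Ψ =>
    R Ψ.1.ofLp ^ m * (Ψ.1.ofLp e ^ (n - m) * star (Ψ.1.ofLp e) ^ n)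
  have hCc : ∀ m, Continuous (C m) := fun m => by fun_prop
  have hC : ∀ m, m ≠ 0 → ∫ Ψ, C m Ψ ∂(haarPure κ) = 0 := by
    intro m hm
    -- Chosen so that `ω ^ m = -1`: rotating the coordinates other than `e` flips the sign of `C m`,
    -- so its integral equals its own negative.
    let ω : ℂ := Complex.exp ((Real.pi / m : ℝ) * Complex.I)
    have hω : ‖ω‖ = 1 := Complex.norm_exp_ofReal_mul_I _
    have hωm : ω ^ m = -1 := by
      rw [← Complex.exp_nat_mul, ← Complex.exp_pi_mul_I]
      congr 1
      push_cast
      field_simp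
    obtain ⟨U, hU⟩ := exists_phase e hω
    have h1 := integral_comp_unitaryAct (hCc m) U
    have h2 : ∀ Ψ : PureState κ, C m (unitaryAct U Ψ) = - C m Ψ := by
      intro Ψ
      have hRU : R (U Ψ.1).ofLp = ω * R Ψ.1.ofLp := by
        simp only [R, Finset.mul_sum]
        refine Finset.sum_congr rfl fun j hj => ?_
        rw [hU, if_neg (Finset.ne_of_mem_erase hj)]
        ring
      simp only [C, unitaryAct]
      rw [hRU, hU, if_pos rfl, one_mul, mul_pow, hωm]
      ring
    simp_rw [h2, integral_neg] at h1
    exact self_eq_neg.mp h1.symm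
  have hexp : ∀ Ψ : PureState κ, (b ⬝ᵥ Ψ.1.ofLp) ^ n * star (Ψ.1.ofLp e) ^ n =
      ∑ m ∈ range (n + 1), (b e ^ (n - m) * n.choose m) * C m Ψ := by
    intro Ψ
    rw [hR, add_pow, Finset.sum_mul]
    refine Finset.sum_congr rfl fun m _ => ?_
    simp only [C, mul_pow]
    ring
  simp_rw [hexp]
  rw [integral_finsetSum _ fun m _ => (integrable_haarPure (hCc m)).const_mul _]
  simp_rw [integral_const_mul]
  rw [Finset.sum_eq_single 0 (fun m _ hm => by rw [hC m hm, mul_zero]) (by simp)]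
  rw [moment, ← integral_complex_ofReal, mul_comm]
  simp only [C, Nat.sub_zero, Nat.choose_zero_right, Nat.cast_one, mul_one, pow_zero, one_mul]
  congr 2
  funext Ψ
  rw [← mul_pow, Complex.star_def, Complex.mul_conj, pow_mul, Complex.normSq_eq_norm_sq]
  push_cast
  rfl

/-- Unitary invariance rotates `a` onto a multiple of a basis vector, which is the preceding case
with `b` rotated accordingly. -/
theorem integral_dotProduct_pow (n : ℕ) (a b : κ → ℂ) :
    ∫ Ψ : PureState κ, (b ⬝ᵥ Ψ.1.ofLp) ^ n * (star Ψ.1.ofLp ⬝ᵥ a) ^ n ∂(haarPure κ) =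
      moment κ n * (b ⬝ᵥ a) ^ n := by
  classical
  set e := Classical.arbitrary κ with he
  obtain ⟨U, hU⟩ := exists_unitary_single e (WithLp.toLp 2 a)
  set r : ℂ := (‖WithLp.toLp 2 a‖ : ℂ)
  have hb : ∀ v : EuclideanSpace ℂ κ, b ⬝ᵥ v.ofLp = inner ℂ (WithLp.toLp 2 (star b)) v := by
    intro v
    simp [EuclideanSpace.inner_eq_star_dotProduct, dotProduct_comm]
  have hUb : ∀ v : EuclideanSpace ℂ κ, b ⬝ᵥ (U v).ofLp =
      star (U.symm (WithLp.toLp 2 (star b))).ofLp ⬝ᵥ v.ofLp := by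
    intro v
    rw [hb, ← U.symm.inner_map_map, U.symm_apply_apply, EuclideanSpace.inner_eq_star_dotProduct,
      dotProduct_comm]
  have hUa : ∀ v : EuclideanSpace ℂ κ, star (U v).ofLp ⬝ᵥ a = r * star (v.ofLp e) := by
    intro v
    have : star (U v).ofLp ⬝ᵥ a = inner ℂ (U v) (WithLp.toLp 2 a) := by
      rw [EuclideanSpace.inner_eq_star_dotProduct, dotProduct_comm]
    rw [this, hU, inner_smul_right, U.inner_map_map, EuclideanSpace.inner_single_right]
    simp
  have hc : Continuous fun Ψ : PureState κ =>
      (b ⬝ᵥ Ψ.1.ofLp) ^ n * (star Ψ.1.ofLp ⬝ᵥ a) ^ n := by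
    unfold dotProduct
    simp only [Pi.star_apply]
    fun_prop
  rw [← integral_comp_unitaryAct hc U]
  simp only [unitaryAct, hUb, hUa, mul_pow, mul_left_comm _ (r ^ n)]
  rw [integral_const_mul, integral_coord_mul_pow]
  have hba : b ⬝ᵥ a = r * star ((U.symm (WithLp.toLp 2 (star b))).ofLp e) := by
    have := hUb (EuclideanSpace.single e 1)
    have h2 : a = r • (U (EuclideanSpace.single e 1)).ofLp := congrArg WithLp.ofLp hU
    rw [h2, dotProduct_smul, this, smul_eq_mul]
    simp
  rw [hba, mul_pow, Pi.star_apply]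
  ring

end Haar

/-! ### Resolution of the identity on the symmetric subspace. -/

section Resolution

variable {P κ : Type*} [Fintype P] [Fintype κ]

theorem continuous_powVec (x : P → κ) : Continuous fun Ψ : PureState κ => powVec Ψ.1.ofLp x := by
  unfold powVec
  fun_prop

/-- The matrix of `∫ |Ψ⟩⟨Ψ|^{⊗ n} dΨ`. -/
noncomputable def haarMoment (x y : P → κ) : ℂ :=
  ∫ Ψ : PureState κ, powVec Ψ.1.ofLp x * star (powVec Ψ.1.ofLp y) ∂(haarPure κ)

theorem star_haarMoment (x y : P → κ) : star (haarMoment x y) = haarMoment y x := by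
  rw [haarMoment, Complex.star_def, ← integral_conj]
  simp only [haarMoment, map_mul, ← Complex.star_def, star_star, mul_comm]

theorem haarMoment_comp_perm (x y : P → κ) (σ : Equiv.Perm P) :
    haarMoment (x ∘ σ) y = haarMoment x y := by
  simp only [haarMoment, powVec_comp_perm]

variable [DecidableEq P]

theorem sum_norm_sq_powVec (Ψ : PureState κ) :
    ∑ x : P → κ, powVec Ψ.1.ofLp x * star (powVec Ψ.1.ofLp x) = 1 := by
  have h : Ψ.1.ofLp ⬝ᵥ star Ψ.1.ofLp = 1 := by
    rw [← EuclideanSpace.inner_eq_star_dotProduct, inner_self_eq_norm_sq_to_K,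
      norm_eq_of_mem_sphere]
    simp
  simp_rw [star_powVec, sum_powVec_mul, h, one_pow]

variable [Nonempty κ]

theorem sum_mul_haarMoment_mul (F G : (P → κ) → ℂ) :
    ∑ x, G x * ∑ y, haarMoment x y * F y =
      ∫ Ψ : PureState κ, (∑ x, G x * powVec Ψ.1.ofLp x) * (∑ y, star (powVec Ψ.1.ofLp y) * F y)
        ∂(haarPure κ) := by
  have hc (x y : P → κ) :
      Continuous fun Ψ : PureState κ => powVec Ψ.1.ofLp x * star (powVec Ψ.1.ofLp y) :=
    (continuous_powVec x).mul (continuous_powVec y).star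
  have h : ∀ Ψ : PureState κ,
      (∑ x, G x * powVec Ψ.1.ofLp x) * (∑ y, star (powVec Ψ.1.ofLp y) * F y) =
        ∑ x, ∑ y, G x * F y * (powVec Ψ.1.ofLp x * star (powVec Ψ.1.ofLp y)) := by
    intro Ψ
    rw [Finset.sum_mul_sum]
    exact Finset.sum_congr rfl fun x _ => Finset.sum_congr rfl fun y _ => by ring
  simp_rw [h]
  rw [integral_finsetSum _ fun x _ => integrable_haarPure
    (continuous_finsetSum _ fun y _ => (hc x y).const_mul _)]
  refine Finset.sum_congr rfl fun x _ => ?_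
  rw [integral_finsetSum _ fun y _ => (integrable_haarPure (hc x y)).const_mul _, Finset.mul_sum]
  refine Finset.sum_congr rfl fun y _ => ?_
  rw [integral_const_mul, haarMoment]
  ring

/-- Both sides are symmetric in `x`, so it suffices to pair them with product vectors `b ⊗ ⋯ ⊗ b`,
where both give the moment times `(b ⬝ᵥ a) ^ n`. -/
theorem sum_haarMoment_mul_powVec (a : κ → ℂ) (x : P → κ) :
    ∑ y, haarMoment x y * powVec a y = moment κ (Fintype.card P) * powVec a x := by
  suffices h : (fun x : P → κ => ∑ y, haarMoment x y * powVec a y -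
      moment κ (Fintype.card P) * powVec a x) = 0 from sub_eq_zero.mp (congrFun h x)
  refine eq_zero_of_forall_sum_powVec_mul (fun σ x => ?_) fun b => ?_
  · simp only [haarMoment_comp_perm, powVec_comp_perm]
  · simp_rw [mul_sub, Finset.sum_sub_distrib, sum_mul_haarMoment_mul, star_powVec,
      sum_powVec_mul, integral_dotProduct_pow, mul_left_comm _ (moment κ _ : ℂ),
      ← Finset.mul_sum, sum_powVec_mul, sub_self]

/-- On symmetric tensors, `∫ |Ψ⟩⟨Ψ|^{⊗ n} dΨ` is a scalar. -/
theorem sum_haarMoment_mul {F : (P → κ) → ℂ}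
    (hF : ∀ (σ : Equiv.Perm P) x, F (x ∘ σ) = F x) (x : P → κ) :
    ∑ y, haarMoment x y * F y = moment κ (Fintype.card P) * F x := by
  suffices h : (fun x : P → κ => ∑ y, haarMoment x y * F y -
      moment κ (Fintype.card P) * F x) = 0 from sub_eq_zero.mp (congrFun h x)
  refine eq_zero_of_forall_sum_powVec_mul (fun σ x => ?_) fun a => ?_
  · simp only [haarMoment_comp_perm, hF]
  -- Hermitian symmetry moves the operator from `F` to the product test vector, where its action is
  -- already known.
  · have h : ∀ y : P → κ, ∑ x, powVec a x * haarMoment x y =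
        moment κ (Fintype.card P) * powVec a y := by
      intro y
      have := congrArg star (sum_haarMoment_mul_powVec (star a) y)
      simpa [star_haarMoment, star_powVec, mul_comm] using this
    simp_rw [mul_sub, Finset.sum_sub_distrib, Finset.mul_sum]
    rw [Finset.sum_comm]
    simp_rw [← mul_assoc, ← Finset.sum_mul, h]
    rw [sub_eq_zero]
    exact Finset.sum_congr rfl fun x _ => by ring

theorem integral_powVec_mul_sum {F : (P → κ) → ℂ}
    (hF : ∀ (σ : Equiv.Perm P) x, F (x ∘ σ) = F x) (x : P → κ) :
    ∫ Ψ : PureState κ, powVec Ψ.1.ofLp x * (∑ y, star (powVec Ψ.1.ofLp y) * F y) ∂(haarPure κ) =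
      moment κ (Fintype.card P) * F x := by
  classical
  have h := sum_mul_haarMoment_mul F (Pi.single x 1)
  simpa [Pi.single_apply, ite_mul, sum_haarMoment_mul hF] using h.symm

/-- Compute the trace of `∫ |Ψ⟩⟨Ψ|^{⊗ n} dΨ` twice. Its range is symmetric, so the trace is that of
a scalar on the symmetric subspace; it is also `∫ ‖Ψ^{⊗ n}‖² dΨ = 1`. -/
theorem moment_mul_symDim (n : ℕ) : moment κ n * symDim κ n = 1 := by
  classical
  let T : EuclideanSpace ℂ (Fin n → κ) →ₗ[ℂ] EuclideanSpace ℂ (Fin n → κ) :=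
    (Matrix.of fun x y => haarMoment x y).toLpLin 2 2
  have hT : ∀ v x, (T v).ofLp x = ∑ y, haarMoment x y * v.ofLp y := fun v x => rfl
  have hmem : ∀ v, T v ∈ symSubspace κ n := by
    intro v σ x
    simp only [hT, haarMoment_comp_perm]
  have hres : T.restrict (fun v _ => hmem v : ∀ v ∈ symSubspace κ n, T v ∈ symSubspace κ n) =
      (moment κ n : ℂ) • LinearMap.id := by
    ext ⟨v, hv⟩ x
    have := sum_haarMoment_mul (F := v.ofLp) hv x
    rw [Fintype.card_fin] at this
    exact (hT v x).trans this
  have h1 := LinearMap.trace_restrict_eq_of_forall_mem (symSubspace κ n) T hmem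
  rw [hres, map_smul, LinearMap.trace_id] at h1
  have h2 : LinearMap.trace ℂ _ T = 1 := by
    have : LinearMap.trace ℂ _ T = (Matrix.of fun x y : Fin n → κ => haarMoment x y).trace := by
      rw [LinearMap.trace_eq_matrix_trace ℂ (PiLp.basisFun 2 ℂ (Fin n → κ))]
      congr 1
      exact LinearMap.toMatrix_toLin _ _ _
    rw [this]
    simp only [Matrix.trace, Matrix.diag, Matrix.of_apply, haarMoment]
    have hi : ∀ x ∈ univ, Integrable (fun Ψ : PureState κ =>
        powVec Ψ.1.ofLp x * star (powVec Ψ.1.ofLp x)) (haarPure κ) := fun (x : Fin n → κ) _ =>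
      integrable_haarPure ((continuous_powVec x).mul (continuous_powVec x).star)
    rw [← integral_finsetSum _ hi]
    simp_rw [sum_norm_sq_powVec]
    simp
  rw [h2, smul_eq_mul] at h1
  exact_mod_cast h1

end Resolution

/-! ### Dual witness for the trace norm. -/

section TraceNorm

variable {α : Type*} [Fintype α] [DecidableEq α]

/-- The witness is `sign A`, since `sign x * x = |x|`. The jump at `0` is harmless because the
spectrum is finite. -/
theorem exists_traceNorm_eq {A : Matrix α α ℂ} (hA : A.IsHermitian) :
    ∃ X : Matrix α α ℂ, X.IsHermitian ∧ (1 - X).PosSemidef ∧ (1 + X).PosSemidef ∧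
      traceNorm A = (X * A).trace.re := by
  have hA' : IsSelfAdjoint A := hA
  have hc : ∀ f : ℝ → ℝ, ContinuousOn f (spectrum ℝ A) := fun f =>
    (Matrix.finite_real_spectrum (A := A)).continuousOn f
  refine ⟨cfc (fun x : ℝ => (SignType.sign x : ℝ)) A, ?_, ?_, ?_, ?_⟩
  · exact cfc_predicate (R := ℝ) (p := IsSelfAdjoint) _ A
  · rw [← Matrix.le_iff]
    exact cfc_le_one _ _ fun x _ => by
      rcases lt_trichotomy x 0 with h | h | h <;> simp [h]
  · have : (-1 : Matrix α α ℂ) ≤ cfc (fun x : ℝ => (SignType.sign x : ℝ)) A := by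
      have h := algebraMap_le_cfc (fun x : ℝ => (SignType.sign x : ℝ)) (-1) A (fun x _ => by
        rcases lt_trichotomy x 0 with h | h | h <;> simp [h]) (hc _) hA'
      simpa using h
    rw [Matrix.le_iff, sub_neg_eq_add, add_comm] at this
    exact this
  · rw [traceNorm, CFC.abs_eq_cfc_norm A hA']
    congr 2
    have h : cfc (fun x : ℝ => (SignType.sign x : ℝ)) A * A =
        cfc (fun x : ℝ => (SignType.sign x : ℝ) * x) A := by
      rw [cfc_mul _ _ A (hc _) (hc _), cfc_id' ℝ A hA']
    rw [h]
    congr 1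
    funext x
    rw [Real.norm_eq_abs, sign_mul_self]

end TraceNorm

/-! ### Compactness of convex hulls. -/

section ConvexHull

/-- By Carathéodory, combinations of at most `dim E + 1` points suffice, so the hull is a finite
union of continuous images of compact sets. -/
theorem isCompact_convexHull {E : Type*} [NormedAddCommGroup E]
    [NormedSpace ℝ E] [FiniteDimensional ℝ E] {s : Set E} (hs : IsCompact s) :
    IsCompact (convexHull ℝ s) := by
  let f (m : ℕ) (p : (Fin m → ℝ) × (Fin m → E)) : E := ∑ i, p.1 i • p.2 i
  have hf : ∀ m, Continuous (f m) := fun m => by fun_prop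
  have h : convexHull ℝ s = ⋃ m ∈ Set.Iic (Module.finrank ℝ E + 1),
      f m '' (stdSimplex ℝ (Fin m) ×ˢ Set.univ.pi fun _ => s) := by
    ext x
    simp only [Set.mem_iUnion, Set.mem_image, Prod.exists, Set.mem_prod, Set.mem_univ_pi,
      exists_prop]
    constructor
    · intro hx
      obtain ⟨ι, _, z, w, hz, hi, hw, hw1, hx⟩ := eq_pos_convex_span_of_mem_convexHull hx
      let e := Fintype.equivFin ι
      refine ⟨Fintype.card ι, ?_, w ∘ e.symm, z ∘ e.symm, ⟨⟨fun i => (hw _).le, ?_⟩, fun i =>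
        hz (Set.mem_range_self _)⟩, ?_⟩
      · exact hi.card_le_finrank_succ.trans (by gcongr; exact Submodule.finrank_le _)
      · rw [← hw1]
        exact e.symm.sum_comp w
      · rw [← hx]
        exact e.symm.sum_comp fun i => w i • z i
    · rintro ⟨m, -, w, z, ⟨hw, hz⟩, rfl⟩
      exact (convex_convexHull ℝ s).sum_mem (fun i _ => hw.1 i) hw.2
        fun i _ => subset_convexHull ℝ s (hz i)
  rw [h]
  exact (Set.finite_Iic _).isCompact_biUnion fun m _ =>
    ((isCompact_stdSimplex ℝ _).prod (isCompact_univ_pi fun _ => hs)).image (hf m)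

end ConvexHull

/-! ### Sesquilinear forms of Hermitian contractions. -/

section QuadraticForm

variable {α : Type*} [Fintype α]

/-- The sesquilinear form `⟨x| Z |y⟩`. -/
def sesq (Z : Matrix α α ℂ) (x y : α → ℂ) : ℂ := star x ⬝ᵥ Z *ᵥ y

theorem sesq_eq_sum (Z : Matrix α α ℂ) (x y : α → ℂ) :
    sesq Z x y = ∑ a, ∑ a', star (x a) * (Z a a' * y a') := by
  simp only [sesq, dotProduct, mulVec, Finset.mul_sum, Pi.star_apply]

theorem sesq_star {Z : Matrix α α ℂ} (hZ : Z.IsHermitian) (x y : α → ℂ) :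
    sesq Z y x = star (sesq Z x y) := by
  rw [sesq, sesq, star_dotProduct, star_mulVec, hZ.eq, dotProduct_mulVec]

theorem sesq_sub_smul_re {Z : Matrix α α ℂ} (hZ : Z.IsHermitian) (r t : ℝ) (x y : α → ℂ) :
    (sesq Z ((r : ℂ) • x - (t : ℂ) • y) ((r : ℂ) • x - (t : ℂ) • y)).re =
      r ^ 2 * (sesq Z x x).re - 2 * (r * t) * (sesq Z x y).re + t ^ 2 * (sesq Z y y).re := by
  have h : sesq Z ((r : ℂ) • x - (t : ℂ) • y) ((r : ℂ) • x - (t : ℂ) • y) =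
      (r : ℂ) ^ 2 * sesq Z x x - (r * t) * (sesq Z x y + sesq Z y x) +
        (t : ℂ) ^ 2 * sesq Z y y := by
    simp only [sesq, mulVec_sub, mulVec_smul, star_sub, star_smul, sub_dotProduct,
      dotProduct_sub, smul_dotProduct, dotProduct_smul, smul_eq_mul, Complex.star_def,
      Complex.conj_ofReal]
    ring
  rw [h, sesq_star hZ x y, Complex.star_def, Complex.add_conj]
  norm_cast
  simp only [Complex.add_re, Complex.sub_re, Complex.re_ofReal_mul, Complex.ofReal_re]
  ring

theorem abs_sesq_re_le [DecidableEq α] {Z : Matrix α α ℂ} (h₁ : (1 - Z).PosSemidef)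
    (h₂ : (1 + Z).PosSemidef) (x : α → ℂ) : |(sesq Z x x).re| ≤ (sesq 1 x x).re := by
  have h3 := (Complex.le_def.mp (h₁.dotProduct_mulVec_nonneg x)).1
  have h4 := (Complex.le_def.mp (h₂.dotProduct_mulVec_nonneg x)).1
  rw [sub_mulVec, dotProduct_sub, Complex.sub_re, Complex.zero_re] at h3
  rw [add_mulVec, dotProduct_add, Complex.add_re, Complex.zero_re] at h4
  rw [abs_le]
  simp only [sesq]
  constructor <;> linarith

theorem continuous_sesq {X : Type*} [TopologicalSpace X] (Z : Matrix α α ℂ) {x y : X → α → ℂ}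
    (hx : Continuous x) (hy : Continuous y) : Continuous fun t => sesq Z (x t) (y t) := by
  simp only [sesq_eq_sum]
  fun_prop

end QuadraticForm

/-! ### The coherent comparison estimate. -/

section Estimate

variable {κ α β : Type*} [Fintype κ] [Nonempty κ] [Fintype α] [Fintype β]

/-- Conjugating the first argument turns `star g` into `g`, which then pairs with `y` under the
integral. It is used both for the square of `v` and for the cross term. -/
theorem integral_sesq_partial (Z : Matrix α α ℂ) (Φ : α → β → ℂ) {g : PureState κ → β → ℂ}
    {y : PureState κ → α → ℂ} (hg : Continuous g) (hy : Continuous y) {c : ℝ}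
    (h : ∀ a b, ∫ Ψ, g Ψ b * y Ψ a ∂(haarPure κ) = c * Φ a b) :
    ∫ Ψ, sesq Z (fun a => ∑ b, star (g Ψ b) * Φ a b) (y Ψ) ∂(haarPure κ) =
      c * ∑ b, sesq Z (Φ · b) (Φ · b) := by
  have hi : ∀ a a' b, Integrable
      (fun Ψ => star (Φ a b) * Z a a' * (g Ψ b * y Ψ a')) (haarPure κ) := fun a a' b =>
    integrable_haarPure (by fun_prop)
  have h1 : ∀ Ψ : PureState κ, sesq Z (fun a => ∑ b, star (g Ψ b) * Φ a b) (y Ψ) =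
      ∑ a, ∑ a', ∑ b, star (Φ a b) * Z a a' * (g Ψ b * y Ψ a') := by
    intro Ψ
    rw [sesq_eq_sum]
    refine Finset.sum_congr rfl fun a _ => Finset.sum_congr rfl fun a' _ => ?_
    rw [star_sum, Finset.sum_mul]
    refine Finset.sum_congr rfl fun b _ => ?_
    rw [star_mul', star_star]
    ring
  simp_rw [h1]
  rw [integral_finsetSum _ fun a _ => integrable_finsetSum _ fun a' _ =>
    integrable_finsetSum _ fun b _ => hi a a' b]
  simp_rw [integral_finsetSum _ fun a' _ => integrable_finsetSum _ fun b _ => hi _ a' b,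
    integral_finsetSum _ fun b _ => hi _ _ b, integral_const_mul, h, sesq_eq_sum, Finset.mul_sum]
  conv_rhs => rw [Finset.sum_comm]
  refine Finset.sum_congr rfl fun a _ => ?_
  conv_rhs => rw [Finset.sum_comm]
  refine Finset.sum_congr rfl fun a' _ => Finset.sum_congr rfl fun b _ => ?_
  ring

theorem integral_re_haarPure {f : PureState κ → ℂ} (hf : Continuous f) :
    ∫ Ψ, (f Ψ).re ∂(haarPure κ) = (∫ Ψ, f Ψ ∂(haarPure κ)).re :=
  integral_re (integrable_haarPure hf)

/-- The coherent comparison of `w = √d₁ v` and `u = √d₂ y`, where `v` is the partial inner product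
of `Φ` with `g`. -/
theorem integral_sesq_difference {Z : Matrix α α ℂ} (hZ : Z.IsHermitian) (Φ : α → β → ℂ)
    {g : PureState κ → β → ℂ} {y : PureState κ → α → ℂ} (hg : Continuous g) (hy : Continuous y)
    {c₁ c₂ d₁ d₂ : ℝ} (hd₁ : 0 < d₁) (hd₂ : 0 < d₂) (h₁ : c₁ * d₁ = 1) (h₂ : c₂ * d₂ = 1)
    (hv : ∀ a b, ∫ Ψ, g Ψ b * ∑ b', star (g Ψ b') * Φ a b' ∂(haarPure κ) = c₁ * Φ a b)
    (hu : ∀ a b, ∫ Ψ, g Ψ b * y Ψ a ∂(haarPure κ) = c₂ * Φ a b) :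
    ∫ Ψ, (sesq Z (((√d₁ : ℝ) : ℂ) • (fun a => ∑ b, star (g Ψ b) * Φ a b) - ((√d₂ : ℝ) : ℂ) • y Ψ)
        (((√d₁ : ℝ) : ℂ) • (fun a => ∑ b, star (g Ψ b) * Φ a b) - ((√d₂ : ℝ) : ℂ) • y Ψ)).re
        ∂(haarPure κ) =
      (1 - 2 * √(d₁ / d₂)) * ∑ b, (sesq Z (Φ · b) (Φ · b)).re +
        d₂ * ∫ Ψ, (sesq Z (y Ψ) (y Ψ)).re ∂(haarPure κ) := by
  let v : PureState κ → α → ℂ := fun Ψ a => ∑ b, star (g Ψ b) * Φ a b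
  have hvc : Continuous v := by fun_prop
  have hsv := integral_sesq_partial Z Φ hg hvc hv
  have hsu := integral_sesq_partial Z Φ hg hy hu
  have hcv := continuous_sesq Z hvc hvc
  have hcm := continuous_sesq Z hvc hy
  have hcu := continuous_sesq Z hy hy
  -- The coefficient of the cross term, using `c₂ = 1 / d₂`.
  have hr : √d₁ * √d₂ * c₂ = √(d₁ / d₂) := by
    rw [Real.sqrt_div hd₁.le, eq_div_iff (Real.sqrt_pos.mpr hd₂).ne']
    linear_combination √d₁ * c₂ * Real.mul_self_sqrt hd₂.le + √d₁ * h₂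
  change ∫ Ψ, (sesq Z (((√d₁ : ℝ) : ℂ) • v Ψ - ((√d₂ : ℝ) : ℂ) • y Ψ)
    (((√d₁ : ℝ) : ℂ) • v Ψ - ((√d₂ : ℝ) : ℂ) • y Ψ)).re ∂(haarPure κ) = _
  simp_rw [sesq_sub_smul_re hZ, Real.sq_sqrt hd₁.le, Real.sq_sqrt hd₂.le]
  have hi1 := (integrable_haarPure (Complex.continuous_re.comp hcv)).const_mul d₁
  have hi2 := (integrable_haarPure (Complex.continuous_re.comp hcm)).const_mul (2 * (√d₁ * √d₂))
  have hi3 := (integrable_haarPure (Complex.continuous_re.comp hcu)).const_mul d₂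
  refine (integral_add (hi1.sub hi2) hi3).trans ?_
  refine congrArg₂ _ ((integral_sub hi1 hi2).trans ?_) (integral_const_mul _ _)
  simp only [Function.comp_apply]
  rw [integral_const_mul, integral_const_mul, integral_re_haarPure hcv, integral_re_haarPure hcm,
    hsv, hsu, Complex.re_ofReal_mul, Complex.re_ofReal_mul, Complex.re_sum, ← hr]
  linear_combination (∑ b, (sesq Z (Φ · b) (Φ · b)).re) * h₁

theorem abs_sesq_difference_le [DecidableEq α] {Z : Matrix α α ℂ} (hZ : Z.IsHermitian)
    (hZ₁ : (1 - Z).PosSemidef) (hZ₂ : (1 + Z).PosSemidef) (Φ : α → β → ℂ)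
    {g : PureState κ → β → ℂ} {y : PureState κ → α → ℂ} (hg : Continuous g) (hy : Continuous y)
    {c₁ c₂ d₁ d₂ : ℝ} (hd₁ : 0 < d₁) (hd₂ : 0 < d₂) (h₁ : c₁ * d₁ = 1) (h₂ : c₂ * d₂ = 1)
    (hv : ∀ a b, ∫ Ψ, g Ψ b * ∑ b', star (g Ψ b') * Φ a b' ∂(haarPure κ) = c₁ * Φ a b)
    (hu : ∀ a b, ∫ Ψ, g Ψ b * y Ψ a ∂(haarPure κ) = c₂ * Φ a b)
    (hΦ : ∑ b, (sesq 1 (Φ · b) (Φ · b)).re = 1)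
    (hn : d₂ * ∫ Ψ, (sesq 1 (y Ψ) (y Ψ)).re ∂(haarPure κ) = 1) :
    |∑ b, (sesq Z (Φ · b) (Φ · b)).re - d₂ * ∫ Ψ, (sesq Z (y Ψ) (y Ψ)).re ∂(haarPure κ)| ≤
      4 * (1 - √(d₁ / d₂)) := by
  have e := integral_sesq_difference hZ Φ hg hy hd₁ hd₂ h₁ h₂ hv hu
  have e1 := integral_sesq_difference (Z := 1) isHermitian_one Φ hg hy hd₁ hd₂ h₁ h₂ hv hu
  rw [hΦ, hn] at e1
  set w : PureState κ → α → ℂ := fun Ψ =>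
    ((√d₁ : ℝ) : ℂ) • (fun a => ∑ b, star (g Ψ b) * Φ a b) - ((√d₂ : ℝ) : ℂ) • y Ψ
  have hw : Continuous w := by
    have hv' : Continuous fun Ψ a => ∑ b, star (g Ψ b) * Φ a b := by fun_prop
    exact (hv'.const_smul ((√d₁ : ℝ) : ℂ)).sub (hy.const_smul ((√d₂ : ℝ) : ℂ))
  change ∫ Ψ, (sesq Z (w Ψ) (w Ψ)).re ∂(haarPure κ) = _ at e
  change ∫ Ψ, (sesq 1 (w Ψ) (w Ψ)).re ∂(haarPure κ) = _ at e1
  have hnn : ∀ x : α → ℂ, 0 ≤ (sesq 1 x x).re := fun x =>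
    (abs_nonneg _).trans (abs_sesq_re_le hZ₁ hZ₂ x)
  have hint : |∫ Ψ, (sesq Z (w Ψ) (w Ψ)).re ∂(haarPure κ)| ≤ 2 * (1 - √(d₁ / d₂)) := by
    calc _ ≤ ∫ Ψ, |(sesq Z (w Ψ) (w Ψ)).re| ∂(haarPure κ) := abs_integral_le_integral_abs
      _ ≤ ∫ Ψ, (sesq 1 (w Ψ) (w Ψ)).re ∂(haarPure κ) :=
        integral_mono
          (integrable_haarPure (Complex.continuous_re.comp (continuous_sesq Z hw hw)).abs)
          (integrable_haarPure (Complex.continuous_re.comp (continuous_sesq 1 hw hw)))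
          fun Ψ => abs_sesq_re_le hZ₁ hZ₂ _
      _ = _ := by rw [e1]; ring
  have hS : |∑ b, (sesq Z (Φ · b) (Φ · b)).re| ≤ 1 :=
    (Finset.abs_sum_le_sum_abs _ _).trans
      ((Finset.sum_le_sum fun b _ => abs_sesq_re_le hZ₁ hZ₂ _).trans hΦ.le)
  -- The bound just proved forces `d₁ ≤ d₂`, so monotonicity of the symmetric dimension is not
  -- needed.
  have hr : 0 ≤ 1 - √(d₁ / d₂) := by linarith [(abs_nonneg _).trans hint]
  have key : ∑ b, (sesq Z (Φ · b) (Φ · b)).re - d₂ * ∫ Ψ, (sesq Z (y Ψ) (y Ψ)).re ∂(haarPure κ) =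
      2 * (1 - √(d₁ / d₂)) * ∑ b, (sesq Z (Φ · b) (Φ · b)).re -
        ∫ Ψ, (sesq Z (w Ψ) (w Ψ)).re ∂(haarPure κ) := by
    rw [e]; ring
  rw [key]
  refine (abs_sub _ _).trans ?_
  rw [abs_mul, abs_of_nonneg (by linarith : 0 ≤ 2 * (1 - √(d₁ / d₂)))]
  have := mul_le_mul_of_nonneg_left hS (by linarith : 0 ≤ 2 * (1 - √(d₁ / d₂)))
  linarith

end Estimate

/-! ### Extending observables trivially to the ancillae. -/

section Lift

variable {ι : Type*} [DecidableEq ι]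

open scoped Kronecker in
/-- The operator `X ⊗ 1` on systems with ancillae. -/
def ancillaLift {P : Type*} [Fintype P] [DecidableEq P] (X : Matrix (P → ι) (P → ι) ℂ) :
    Matrix (P → ι × ι) (P → ι × ι) ℂ :=
  (X ⊗ₖ (1 : Matrix (P → ι) (P → ι) ℂ)).submatrix
    (Equiv.arrowProdEquivProdArrow P (fun _ => ι) fun _ => ι)
    (Equiv.arrowProdEquivProdArrow P (fun _ => ι) fun _ => ι)

variable {P : Type*} [Fintype P] [DecidableEq P]

theorem ancillaLift_pair (X : Matrix (P → ι) (P → ι) ℂ) (x w y w' : P → ι) :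
    ancillaLift X (fun i => (x i, w i)) (fun i => (y i, w' i)) =
      X x y * (1 : Matrix (P → ι) (P → ι) ℂ) w w' := rfl

theorem ancillaLift_one : ancillaLift (1 : Matrix (P → ι) (P → ι) ℂ) = 1 := by
  rw [ancillaLift, one_kronecker_one, submatrix_one_equiv]

theorem ancillaLift_add (X Y : Matrix (P → ι) (P → ι) ℂ) :
    ancillaLift (X + Y) = ancillaLift X + ancillaLift Y := by
  rw [ancillaLift, add_kronecker, submatrix_add]
  rfl

theorem ancillaLift_sub (X Y : Matrix (P → ι) (P → ι) ℂ) :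
    ancillaLift (X - Y) = ancillaLift X - ancillaLift Y := by
  rw [eq_sub_iff_add_eq, ← ancillaLift_add, sub_add_cancel]

theorem isHermitian_ancillaLift {X : Matrix (P → ι) (P → ι) ℂ} (hX : X.IsHermitian) :
    (ancillaLift X).IsHermitian := by
  refine IsHermitian.submatrix ?_ _
  rw [IsHermitian, conjTranspose_kronecker, hX.eq, conjTranspose_one]

theorem posSemidef_ancillaLift [Fintype ι] {X : Matrix (P → ι) (P → ι) ℂ} (hX : X.PosSemidef) :
    (ancillaLift X).PosSemidef :=
  (hX.kronecker PosSemidef.one).submatrix _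

end Lift

/-! ### Partial traces in coordinates. -/

section PartialTrace

variable {ι : Type*} [Fintype ι] {n : ℕ}

theorem traceAncillae_ketBra_apply (Θ : EuclideanSpace ℂ (Fin n → ι × ι)) (x y : Fin n → ι) :
    traceAncillae (ketBra Θ) x y =
      ∑ w : Fin n → ι, Θ.ofLp (fun i => (x i, w i)) * star (Θ.ofLp fun i => (y i, w i)) := rfl

/-- Joining a configuration of the systems in `S` with one of the other systems. -/
def glue {κ : Type*} (S : Finset (Fin n)) (a : S → κ) (b : {i // i ∉ S} → κ) : Fin n → κ :=
  (Equiv.piEquivPiSubtypeProd (fun i => i ∈ S) fun _ => κ).symm (a, b)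

theorem glue_apply {κ : Type*} (S : Finset (Fin n)) (a : S → κ) (b : {i // i ∉ S} → κ)
    (i : Fin n) : glue S a b i = if h : i ∈ S then a ⟨i, h⟩ else b ⟨i, h⟩ := rfl

theorem sum_glue {κ : Type*} [Fintype κ] (S : Finset (Fin n)) (F : (Fin n → κ) → ℂ) :
    ∑ a, ∑ b, F (glue S a b) = ∑ x, F x := by
  rw [← (Equiv.piEquivPiSubtypeProd (fun i => i ∈ S) fun _ => κ).symm.sum_comp,
    Fintype.sum_prod_type]
  rfl

theorem powVec_glue {κ : Type*} (S : Finset (Fin n)) (ψ : κ → ℂ) (a : S → κ)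
    (b : {i // i ∉ S} → κ) : powVec ψ (glue S a b) = powVec ψ a * powVec ψ b := by
  unfold powVec
  rw [← Fintype.prod_subtype_mul_prod_subtype (fun i => i ∈ S)]
  refine congrArg₂ _ (Finset.prod_congr (Finset.ext fun _ => by simp) fun i _ => ?_)
    (Finset.prod_congr (Finset.ext fun _ => by simp) fun i _ => ?_)
  · rw [glue_apply, dif_pos i.2]
  · rw [glue_apply, dif_neg i.2]

theorem glue_comp_perm {κ : Type*} (S : Finset (Fin n)) (a : S → κ) (b : {i // i ∉ S} → κ)
    (σ : Equiv.Perm {i // i ∉ S}) :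
    glue S a (b ∘ σ) = glue S a b ∘ Equiv.Perm.ofSubtype σ := by
  funext i
  by_cases h : i ∈ S
  · rw [Function.comp_apply, Equiv.Perm.ofSubtype_apply_of_not_mem σ (not_not.mpr h), glue_apply,
      glue_apply, dif_pos h, dif_pos h]
  · rw [Function.comp_apply, Equiv.Perm.ofSubtype_apply_of_mem σ h, glue_apply, glue_apply,
      dif_neg h, dif_neg (σ ⟨i, h⟩).2]
    rfl

theorem reduced_apply (S : Finset (Fin n)) (A : Matrix (Fin n → ι) (Fin n → ι) ℂ) (x y : S → ι) :
    reduced S A x y = ∑ z, A (glue S x z) (glue S y z) := rfl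

theorem trace_reduced (S : Finset (Fin n))
    (A : Matrix (Fin n → ι) (Fin n → ι) ℂ) : (reduced S A).trace = A.trace :=
  sum_glue S fun x => A x x

theorem isHermitian_reduced (S : Finset (Fin n)) {A : Matrix (Fin n → ι) (Fin n → ι) ℂ}
    (hA : A.IsHermitian) : (reduced S A).IsHermitian := by
  refine IsHermitian.ext fun x y => ?_
  simp only [reduced_apply, star_sum]
  exact Finset.sum_congr rfl fun z _ => hA.apply _ _

theorem trace_traceAncillae_ketBra (Θ : EuclideanSpace ℂ (Fin n → ι × ι)) :
    (traceAncillae (ketBra Θ)).trace = ∑ x, Θ.ofLp x * star (Θ.ofLp x) := by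
  rw [← (Equiv.arrowProdEquivProdArrow (Fin n) (fun _ => ι) fun _ => ι).symm.sum_comp,
    Fintype.sum_prod_type]
  rfl

theorem posSemidef_traceAncillae_ketBra (Θ : EuclideanSpace ℂ (Fin n → ι × ι)) :
    (traceAncillae (ketBra Θ)).PosSemidef := by
  let B : Matrix (Fin n → ι) (Fin n → ι) ℂ := Matrix.of fun x w => Θ.ofLp fun i => (x i, w i)
  exact posSemidef_self_mul_conjTranspose B

/-- Expanding the product of single-ancilla sums gives one sum over ancilla configurations. -/
theorem tensorPow_localState (Ψ : PureState (ι × ι)) :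
    tensorPow n (localState Ψ) = traceAncillae (ketBra (WithLp.toLp 2 (powVec Ψ.1.ofLp))) := by
  ext x y
  rw [traceAncillae_ketBra_apply]
  change ∏ i, ∑ z, Ψ.1.ofLp (x i, z) * star (Ψ.1.ofLp (y i, z)) = _
  classical
  rw [Fintype.prod_sum]
  refine Finset.sum_congr rfl fun w _ => ?_
  simp only [powVec, star_prod, Finset.prod_mul_distrib]

theorem isState_localState (Ψ : PureState (ι × ι)) : IsState (localState Ψ) := by
  constructor
  · let B : Matrix ι ι ℂ := Matrix.of fun x w => Ψ.1.ofLp (x, w)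
    exact posSemidef_self_mul_conjTranspose B
  · have h : (localState Ψ).trace = ∑ p : ι × ι, Ψ.1.ofLp p * star (Ψ.1.ofLp p) := by
      rw [Fintype.sum_prod_type]
      rfl
    have := sum_norm_sq_powVec (P := Fin 1) Ψ
    rw [h, ← this, ← (Equiv.funUnique (Fin 1) (ι × ι)).sum_comp]
    simp [powVec]

theorem isState_tensorPow_localState (Ψ : PureState (ι × ι)) :
    IsState (tensorPow n (localState Ψ)) := by
  rw [tensorPow_localState]
  exact ⟨posSemidef_traceAncillae_ketBra _,
    (trace_traceAncillae_ketBra _).trans (sum_norm_sq_powVec Ψ)⟩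

theorem convex_isState {α : Type*} [Fintype α] : Convex ℝ {A : Matrix α α ℂ | IsState A} := by
  intro A hA B hB a b ha hb hab
  refine ⟨(hA.1.smul ha).add (hB.1.smul hb), ?_⟩
  rw [trace_add, trace_smul, trace_smul, hA.2, hB.2, ← add_smul, hab, one_smul]

theorem sum_reorder {A B C D E : Type*} [Fintype A] [Fintype B] [Fintype C] [Fintype D] [Fintype E]
    (F : A → B → C → D → E → ℂ) :
    ∑ a, ∑ b, ∑ c, ∑ d, ∑ e, F a b c d e = ∑ c, ∑ e, ∑ a, ∑ d, ∑ b, F a b c d e := by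
  calc _ = ∑ a, ∑ c, ∑ b, ∑ d, ∑ e, F a b c d e :=
        Finset.sum_congr rfl fun a _ => Finset.sum_comm
    _ = ∑ c, ∑ a, ∑ b, ∑ e, ∑ d, F a b c d e := by
        rw [Finset.sum_comm]
        exact Finset.sum_congr rfl fun c _ => Finset.sum_congr rfl fun a _ =>
          Finset.sum_congr rfl fun b _ => Finset.sum_comm
    _ = ∑ c, ∑ a, ∑ e, ∑ d, ∑ b, F a b c d e :=
        Finset.sum_congr rfl fun c _ => Finset.sum_congr rfl fun a _ => by
          rw [Finset.sum_comm]
          exact Finset.sum_congr rfl fun e _ => Finset.sum_comm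
    _ = _ := Finset.sum_congr rfl fun c _ => Finset.sum_comm

variable [DecidableEq ι]

/-- Lets the estimate run on pairs of system and ancilla: the traced-out pairs become the index `b`,
while the ancillae in `S` stay and are acted on by the identity. -/
theorem trace_mul_reduced_traceAncillae (S : Finset (Fin n)) (X : Matrix (S → ι) (S → ι) ℂ)
    (Θ : EuclideanSpace ℂ (Fin n → ι × ι)) :
    (X * reduced S (traceAncillae (ketBra Θ))).trace =
      ∑ b, sesq (ancillaLift X) (fun a => Θ.ofLp (glue S a b)) fun a => Θ.ofLp (glue S a b) := by
  let pair {P : Type} (x w : P → ι) (i : P) : ι × ι := (x i, w i)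
  have hg : ∀ (x : S → ι) (z : {i // i ∉ S} → ι) (w : S → ι) (w' : {i // i ∉ S} → ι),
      (fun i => (glue S x z i, glue S w w' i)) = glue S (pair x w) (pair z w') := by
    intro x z w w'
    funext i
    simp only [glue_apply, pair]
    split_ifs <;> rfl
  have hsum : ∀ {P : Type} [Fintype P] [DecidableEq P] (F : (P → ι × ι) → ℂ),
      ∑ a, F a = ∑ x, ∑ w, F (pair x w) := by
    intro P _ _ F
    rw [← (Equiv.arrowProdEquivProdArrow P (fun _ => ι) fun _ => ι).symm.sum_comp,
      Fintype.sum_prod_type]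
    rfl
  have hL : (X * reduced S (traceAncillae (ketBra Θ))).trace =
      ∑ x, ∑ y, ∑ z, ∑ w, ∑ w', X x y * (Θ.ofLp (glue S (pair y w) (pair z w')) *
        star (Θ.ofLp (glue S (pair x w) (pair z w')))) := by
    simp only [Matrix.trace, Matrix.diag, Matrix.mul_apply]
    refine Finset.sum_congr rfl fun x _ => Finset.sum_congr rfl fun y _ => ?_
    rw [reduced_apply, Finset.mul_sum]
    refine Finset.sum_congr rfl fun z _ => ?_
    rw [traceAncillae_ketBra_apply, ← sum_glue S, Finset.mul_sum]
    refine Finset.sum_congr rfl fun w _ => ?_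
    rw [Finset.mul_sum]
    refine Finset.sum_congr rfl fun w' _ => ?_
    rw [hg, hg]
  rw [hL, sum_reorder, hsum]
  refine Finset.sum_congr rfl fun z _ => Finset.sum_congr rfl fun w' _ => ?_
  rw [sesq_eq_sum, hsum]
  refine Finset.sum_congr rfl fun x _ => Finset.sum_congr rfl fun w _ => ?_
  rw [hsum]
  refine Finset.sum_congr rfl fun y _ => ?_
  rw [Finset.sum_eq_single w]
  · rw [ancillaLift_pair, Matrix.one_apply_eq]
    ring
  · intro u _ hu
    rw [ancillaLift_pair, Matrix.one_apply_ne hu.symm]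
    ring
  · simp

end PartialTrace

/-! ### The density as a squared amplitude. -/

section Density

variable {κ : Type*} [Fintype κ] {n : ℕ}

/-- The amplitude `⟨Ψ^{⊗ n}|Φ⟩`. -/
def amplitude (Φ : EuclideanSpace ℂ (Fin n → κ)) (Ψ : PureState κ) : ℂ :=
  ∑ x, star (powVec Ψ.1.ofLp x) * Φ.ofLp x

theorem continuous_amplitude (Φ : EuclideanSpace ℂ (Fin n → κ)) : Continuous (amplitude Φ) :=
  continuous_finsetSum _ fun x _ => (continuous_powVec x).star.mul continuous_const

theorem density_eq (Φ : EuclideanSpace ℂ (Fin n → κ)) (Ψ : PureState κ) :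
    density Φ Ψ = symDim κ n * (amplitude Φ Ψ * star (amplitude Φ Ψ)) := by
  rw [density, smul_mul_assoc, trace_smul, smul_eq_mul]
  congr 1
  simp only [Matrix.trace, Matrix.diag, Matrix.mul_apply, amplitude, star_sum, star_mul', star_star]
  rw [mul_comm, Finset.sum_mul_sum]
  refine Finset.sum_congr rfl fun x _ => Finset.sum_congr rfl fun y _ => ?_
  have h : tensorPow n (ketBra (Ψ : EuclideanSpace ℂ κ)) x y =
      powVec Ψ.1.ofLp x * star (powVec Ψ.1.ofLp y) := by
    rw [powVec, powVec, star_prod, ← Finset.prod_mul_distrib]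
    rfl
  have h2 : ketBra Φ y x = Φ.ofLp y * star (Φ.ofLp x) := rfl
  rw [h, h2]
  ring

theorem density_eq_ofReal (Φ : EuclideanSpace ℂ (Fin n → κ)) (Ψ : PureState κ) :
    density Φ Ψ = ((symDim κ n * ‖amplitude Φ Ψ‖ ^ 2 : ℝ) : ℂ) := by
  rw [density_eq, Complex.star_def, Complex.mul_conj']
  push_cast
  rfl

theorem density_nonneg (Φ : EuclideanSpace ℂ (Fin n → κ)) (Ψ : PureState κ) :
    0 ≤ density Φ Ψ := by
  rw [density_eq_ofReal, Complex.zero_le_real]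
  positivity

theorem continuous_density (Φ : EuclideanSpace ℂ (Fin n → κ)) : Continuous (density Φ) := by
  have := continuous_amplitude Φ
  simp_rw [funext (density_eq Φ)]
  fun_prop

variable [Nonempty κ]

theorem integral_density {Φ : EuclideanSpace ℂ (Fin n → κ)} (hΦ : Φ ∈ symSubspace κ n) :
    ∫ Ψ, density Φ Ψ ∂(haarPure κ) = ∑ x, Φ.ofLp x * star (Φ.ofLp x) := by
  have hi : ∀ x, Integrable (fun Ψ => symDim κ n * star (Φ.ofLp x) *
      (powVec Ψ.1.ofLp x * amplitude Φ Ψ)) (haarPure κ) := fun x =>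
    integrable_haarPure (((continuous_powVec x).mul (continuous_amplitude Φ)).const_mul _)
  have h : ∀ Ψ, density Φ Ψ = ∑ x, symDim κ n * star (Φ.ofLp x) *
      (powVec Ψ.1.ofLp x * amplitude Φ Ψ) := by
    intro Ψ
    have hs : star (amplitude Φ Ψ) = ∑ x, powVec Ψ.1.ofLp x * star (Φ.ofLp x) := by
      simp only [amplitude, star_sum, star_mul', star_star]
    rw [density_eq, hs, Finset.mul_sum, Finset.mul_sum]
    exact Finset.sum_congr rfl fun x _ => by ring
  simp_rw [h]
  rw [integral_finsetSum _ fun x _ => hi x]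
  refine Finset.sum_congr rfl fun x _ => ?_
  have h1 := integral_powVec_mul_sum (F := Φ.ofLp) hΦ x
  have h2 : (moment κ n : ℂ) * symDim κ n = 1 := mod_cast moment_mul_symDim n
  rw [Fintype.card_fin] at h1
  rw [integral_const_mul]
  simp only [amplitude]
  rw [h1]
  linear_combination (star (Φ.ofLp x) * Φ.ofLp x) * h2

end Density

/-! ### A symmetric purification. -/

section Purification

variable {ι : Type*} [Fintype ι] [DecidableEq ι] {n : ℕ}

theorem exists_symmetric_purification {ρ : Matrix (Fin n → ι) (Fin n → ι) ℂ}
    (hρ : ρ.PosSemidef) (hinv : IsPermInvariant ρ) :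
    ∃ Φ ∈ symSubspace (ι × ι) n, Purifies Φ ρ := by
  have hB : (CFC.sqrt ρ).PosSemidef := nonneg_iff_posSemidef.mp (CFC.sqrt_nonneg ρ)
  have hBB : CFC.sqrt ρ * CFC.sqrt ρ = ρ := CFC.sqrt_mul_sqrt_self ρ hρ.nonneg
  refine ⟨WithLp.toLp 2 fun x => CFC.sqrt ρ (fun i => (x i).1) fun i => (x i).2, ?_, ?_⟩
  · intro σ x
    let e : (Fin n → ι) ≃ (Fin n → ι) := Equiv.arrowCongr σ⁻¹ (Equiv.refl ι)
    have he : ∀ y, e y = y ∘ σ := fun y => rfl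
    have h1 : (CFC.sqrt ρ).submatrix e e * (CFC.sqrt ρ).submatrix e e = ρ := by
      rw [submatrix_mul_equiv, hBB]
      ext y z
      exact hinv σ y z
    -- The permuted root is another positive root of `ρ`, so it equals `√ρ`; this is the symmetry of
    -- the purifying vector.
    have h2 := CFC.sqrt_unique h1 (hB.submatrix e).nonneg
    exact (congrFun (congrFun h2 fun i => (x i).1) fun i => (x i).2).symm
  · ext x y
    rw [traceAncillae_ketBra_apply]
    conv_rhs => rw [← hBB, Matrix.mul_apply]
    exact Finset.sum_congr rfl fun w _ => by rw [hB.1.apply]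

end Purification

/-! ### Separability of the mixture. -/

section Separable

variable {ι : Type*} [Fintype ι] {n : ℕ}

theorem continuous_tensorPow_localState :
    Continuous fun Ψ : PureState (ι × ι) => tensorPow n (localState Ψ) := by
  simp_rw [tensorPow_localState]
  refine continuous_matrix fun x y => ?_
  simp only [traceAncillae_ketBra_apply]
  exact continuous_finsetSum _ fun w _ => (continuous_powVec _).mul (continuous_powVec _).star

/-- The mixture is the mean of a continuous function under the probability measure `p dΨ`. Means lie
in the closed convex hull, and the hull of a compact range is already closed. -/
theorem deFinettiState_mem_convexHull [Nonempty ι] {Φ : EuclideanSpace ℂ (Fin n → ι × ι)}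
    (hΦ : ∫ Ψ, density Φ Ψ ∂(haarPure (ι × ι)) = 1) :
    deFinettiState Φ ∈
      convexHull ℝ (Set.range fun Ψ : PureState (ι × ι) => tensorPow n (localState Ψ)) := by
  let p : PureState (ι × ι) → NNReal := fun Ψ =>
    ⟨symDim (ι × ι) n * ‖amplitude Φ Ψ‖ ^ 2, by positivity⟩
  have hp : ∀ Ψ, density Φ Ψ = ((p Ψ : ℝ) : ℂ) := density_eq_ofReal Φ
  have hpc : Continuous p :=
    Continuous.subtype_mk (((continuous_amplitude Φ).norm.pow 2).const_mul _) _
  have hp1 : ∫ Ψ, (p Ψ : ℝ) ∂(haarPure (ι × ι)) = 1 := by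
    simp_rw [hp] at hΦ
    rw [integral_complex_ofReal] at hΦ
    exact_mod_cast hΦ
  let μ : Measure (PureState (ι × ι)) := (haarPure (ι × ι)).withDensity fun Ψ => (p Ψ : ENNReal)
  have hμ : IsProbabilityMeasure μ := by
    refine ⟨?_⟩
    have hi : Integrable (fun Ψ => (p Ψ : ℝ)) (haarPure (ι × ι)) :=
      integrable_haarPure (NNReal.continuous_coe.comp hpc)
    rw [withDensity_apply _ MeasurableSet.univ, Measure.restrict_univ]
    have := ofReal_integral_eq_lintegral_ofReal hi (Filter.Eventually.of_forall fun Ψ => (p Ψ).2)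
    rw [hp1, ENNReal.ofReal_one] at this
    simpa using this.symm
  let T : PureState (ι × ι) → (Fin n → ι) → (Fin n → ι) → ℂ :=
    fun Ψ x y => tensorPow n (localState Ψ) x y
  have hT : Continuous T := continuous_pi fun x => continuous_pi fun y =>
    continuous_tensorPow_localState.matrix_elem x y
  have hTi : Integrable T μ :=
    hT.integrable_of_hasCompactSupport (HasCompactSupport.of_compactSpace _)
  have key : deFinettiState Φ = Matrix.ofLinearEquiv ℝ (∫ Ψ, T Ψ ∂μ) := by
    ext x y
    let L : ((Fin n → ι) → (Fin n → ι) → ℂ) →L[ℝ] ℂ :=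
      (ContinuousLinearMap.proj (R := ℝ) (φ := fun _ : Fin n → ι => ℂ) y).comp
        (ContinuousLinearMap.proj (R := ℝ) (φ := fun _ : Fin n → ι => (Fin n → ι) → ℂ) x)
    change _ = L _
    rw [← L.integral_comp_comm hTi, integral_withDensity_eq_integral_smul hpc.measurable]
    refine integral_congr_ae (Filter.Eventually.of_forall fun Ψ => ?_)
    simp only [hp, NNReal.smul_def, Complex.real_smul]
    rfl
  have hK := isCompact_convexHull (isCompact_range hT)
  have hmem := (convex_convexHull ℝ _).integral_mem hK.isClosed
    (Filter.Eventually.of_forall fun Ψ => subset_convexHull ℝ _ (Set.mem_range_self Ψ)) hTi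
  have himage := Set.mem_image_of_mem (Matrix.ofLinearEquiv ℝ).toLinearMap hmem
  rw [LinearMap.image_convexHull, ← Set.range_comp] at himage
  rw [key]
  exact himage

end Separable

/-! ### Applying the estimate to the reduced states. -/

section Reduction

variable {ι : Type*} [Fintype ι] [DecidableEq ι] [Nonempty ι] {n : ℕ}

theorem trace_mul_reduced_deFinettiState (S : Finset (Fin n)) (X : Matrix (S → ι) (S → ι) ℂ)
    (Φ : EuclideanSpace ℂ (Fin n → ι × ι)) :
    (X * reduced S (deFinettiState Φ)).trace =
      ∫ Ψ, density Φ Ψ * sesq (ancillaLift X) (powVec Ψ.1.ofLp) (powVec Ψ.1.ofLp)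
        ∂(haarPure (ι × ι)) := by
  have hlocal : ∀ Ψ : PureState (ι × ι),
      sesq (ancillaLift X) (powVec Ψ.1.ofLp) (powVec Ψ.1.ofLp) =
        (X * reduced S (tensorPow n (localState Ψ))).trace := by
    intro Ψ
    rw [tensorPow_localState, trace_mul_reduced_traceAncillae]
    simp only [powVec_glue, sesq_eq_sum]
    -- The traced-out factors contribute the squared norm of a product of unit vectors, written here
    -- in place of `1`.
    rw [← mul_one (∑ a, _), ← sum_norm_sq_powVec (P := {i // i ∉ S}) Ψ, Finset.mul_sum]
    refine Finset.sum_congr rfl fun b _ => ?_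
    simp only [Finset.sum_mul]
    refine Finset.sum_congr rfl fun a _ => Finset.sum_congr rfl fun a' _ => ?_
    rw [star_mul']
    ring
  have hc : ∀ x y, Continuous fun Ψ : PureState (ι × ι) =>
      density Φ Ψ * tensorPow n (localState Ψ) x y := fun x y =>
    (continuous_density Φ).mul (continuous_tensorPow_localState.matrix_elem x y)
  have hexp : ∀ Ψ : PureState (ι × ι),
      density Φ Ψ * sesq (ancillaLift X) (powVec Ψ.1.ofLp) (powVec Ψ.1.ofLp) =
        ∑ x, ∑ y, ∑ z, X x y *
          (density Φ Ψ * tensorPow n (localState Ψ) (glue S y z) (glue S x z)) := by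
    intro Ψ
    rw [hlocal]
    simp only [Matrix.trace, Matrix.diag, Matrix.mul_apply, reduced_apply, Finset.mul_sum]
    refine Finset.sum_congr rfl fun x _ => Finset.sum_congr rfl fun y _ =>
      Finset.sum_congr rfl fun z _ => by ring
  have hi : ∀ x y z, Integrable (fun Ψ => X x y *
      (density Φ Ψ * tensorPow n (localState Ψ) (glue S y z) (glue S x z)))
      (haarPure (ι × ι)) := fun x y z => (integrable_haarPure (hc _ _)).const_mul _
  simp_rw [hexp]
  rw [integral_finsetSum _ fun x _ => integrable_finsetSum _ fun y _ =>
    integrable_finsetSum _ fun z _ => hi x y z]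
  refine Finset.sum_congr rfl fun x _ => ?_
  rw [integral_finsetSum _ fun y _ => integrable_finsetSum _ fun z _ => hi x y z]
  refine Finset.sum_congr rfl fun y _ => ?_
  rw [integral_finsetSum _ fun z _ => hi x y z]
  simp_rw [integral_const_mul, ← Finset.mul_sum]
  rfl

theorem trace_mul_reduced_deFinettiState_re (S : Finset (Fin n))
    (X : Matrix (S → ι) (S → ι) ℂ) (Φ : EuclideanSpace ℂ (Fin n → ι × ι)) :
    (X * reduced S (deFinettiState Φ)).trace.re =
      symDim (ι × ι) n * ∫ Ψ, (sesq (ancillaLift X) (amplitude Φ Ψ • powVec Ψ.1.ofLp)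
        (amplitude Φ Ψ • powVec Ψ.1.ofLp)).re ∂(haarPure (ι × ι)) := by
  have hf : Continuous fun Ψ : PureState (ι × ι) => (powVec Ψ.1.ofLp : (S → ι × ι) → ℂ) :=
    continuous_pi continuous_powVec
  have hc := (continuous_density Φ).mul (continuous_sesq (ancillaLift X) hf hf)
  rw [trace_mul_reduced_deFinettiState, ← integral_const_mul]
  refine (integral_re_haarPure hc).symm.trans ?_
  refine integral_congr_ae (Filter.Eventually.of_forall fun Ψ => ?_)
  simp only [Pi.mul_apply, density_eq_ofReal, Complex.re_ofReal_mul]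
  have : sesq (ancillaLift X) (amplitude Φ Ψ • powVec Ψ.1.ofLp)
      (amplitude Φ Ψ • powVec Ψ.1.ofLp) = ((‖amplitude Φ Ψ‖ ^ 2 : ℝ) : ℂ) *
        sesq (ancillaLift X) (powVec Ψ.1.ofLp) (powVec Ψ.1.ofLp) := by
    push_cast
    rw [← Complex.mul_conj']
    simp only [sesq, star_smul, smul_dotProduct, mulVec_smul, dotProduct_smul, smul_eq_mul,
      Complex.star_def]
    ring
  rw [this, Complex.re_ofReal_mul]
  ring

theorem symDim_pos {κ : Type*} [Fintype κ] [Nonempty κ] (m : ℕ) : (0 : ℝ) < symDim κ m := by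
  rw [Nat.cast_pos, Nat.pos_iff_ne_zero]
  intro h
  have := moment_mul_symDim (κ := κ) m
  simp [h] at this

theorem traceNorm_reduced_sub_le {ρ : Matrix (Fin n → ι) (Fin n → ι) ℂ} (hρ : IsState ρ)
    {Φ : EuclideanSpace ℂ (Fin n → ι × ι)} (hΦ : Φ ∈ symSubspace (ι × ι) n)
    (hpur : Purifies Φ ρ) (hdf : IsState (deFinettiState Φ)) (S : Finset (Fin n)) :
    traceNorm (reduced S ρ - reduced S (deFinettiState Φ)) ≤
      4 * (1 - √((symDim (ι × ι) (n - S.card) : ℝ) / symDim (ι × ι) n)) := by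
  obtain ⟨X, hX, hX₁, hX₂, hnorm⟩ := exists_traceNorm_eq
    ((isHermitian_reduced S hρ.1.1).sub (isHermitian_reduced S hdf.1.1))
  have hlift₁ : (1 - ancillaLift X).PosSemidef := by
    rw [← ancillaLift_one, ← ancillaLift_sub]
    exact posSemidef_ancillaLift hX₁
  have hlift₂ : (1 + ancillaLift X).PosSemidef := by
    rw [← ancillaLift_one, ← ancillaLift_add]
    exact posSemidef_ancillaLift hX₂
  have htr : ∀ Y : Matrix (S → ι) (S → ι) ℂ, (Y * reduced S ρ).trace.re =
      ∑ b, (sesq (ancillaLift Y) (fun a => Φ.ofLp (glue S a b))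
        fun a => Φ.ofLp (glue S a b)).re := by
    intro Y
    rw [← show traceAncillae (ketBra Φ) = ρ from hpur, trace_mul_reduced_traceAncillae,
      Complex.re_sum]
  have hone : ∀ A : Matrix (Fin n → ι) (Fin n → ι) ℂ, IsState A →
      ((1 : Matrix (S → ι) (S → ι) ℂ) * reduced S A).trace.re = 1 := by
    intro A hA
    rw [one_mul, trace_reduced, hA.2, Complex.one_re]
  have hcard : Fintype.card {i // i ∉ S} = n - S.card := by
    rw [Fintype.card_subtype_compl, Fintype.card_fin, Fintype.card_coe]
  rw [hnorm, mul_sub, trace_sub, Complex.sub_re, htr, trace_mul_reduced_deFinettiState_re]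
  refine (le_abs_self _).trans (abs_sesq_difference_le (isHermitian_ancillaLift hX) hlift₁ hlift₂
    (fun a b => Φ.ofLp (glue S a b)) (g := fun Ψ => powVec Ψ.1.ofLp)
    (y := fun Ψ => amplitude Φ Ψ • powVec Ψ.1.ofLp) (continuous_pi continuous_powVec)
    ((continuous_amplitude Φ).smul (continuous_pi continuous_powVec)) (symDim_pos _)
    (symDim_pos _) (moment_mul_symDim _) (moment_mul_symDim _) ?_ ?_ ?_ ?_)
  -- For fixed `a`, `Φ` is symmetric in the systems outside `S`: resolution on `n - S.card` systems.
  · intro a b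
    rw [integral_powVec_mul_sum (F := fun b => Φ.ofLp (glue S a b)), hcard]
    intro σ b
    rw [glue_comp_perm]
    exact hΦ _ _
  -- Here `g` and the vector in `y` recombine to `Ψ^{⊗ n}`: resolution on all `n` systems.
  · intro a b
    have h := integral_powVec_mul_sum (F := Φ.ofLp) hΦ (glue S a b)
    rw [Fintype.card_fin] at h
    rw [← h]
    refine integral_congr_ae (Filter.Eventually.of_forall fun Ψ => ?_)
    simp only [powVec_glue, Pi.smul_apply, smul_eq_mul, amplitude]
    ring
  · rw [← ancillaLift_one, ← htr, hone ρ hρ]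
  · rw [← ancillaLift_one, ← trace_mul_reduced_deFinettiState_re, hone _ hdf]

end Reduction

end QDeFinetti

theorem lemma3 {ι : Type*} [Fintype ι] [DecidableEq ι] [Nonempty ι] (M : ℕ)
    (ρ : Matrix (Fin M → ι) (Fin M → ι) ℂ) (hρ : IsState ρ) (hinv : IsPermInvariant ρ) :
    (∃ Φ ∈ symSubspace (ι × ι) M, Purifies Φ ρ) ∧
    ∀ Φ ∈ symSubspace (ι × ι) M, Purifies Φ ρ →
      (∀ Ψ, 0 ≤ density Φ Ψ) ∧
      ∫ Ψ, density Φ Ψ ∂(haarPure (ι × ι)) = 1 ∧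
      IsState (deFinettiState Φ) ∧
      IsFullySeparable (deFinettiState Φ) ∧
      ∀ (k : ℕ) (S : Finset (Fin M)), S.card = k →
        traceNorm (reduced S ρ - reduced S (deFinettiState Φ)) ≤
          4 * (1 - √((symDim (ι × ι) (M - k) : ℝ) / (symDim (ι × ι) M : ℝ))) := by
  refine ⟨exists_symmetric_purification hρ.1 hinv, fun Φ hΦ hpur => ?_⟩
  have hint : ∫ Ψ, density Φ Ψ ∂(haarPure (ι × ι)) = 1 := by
    rw [integral_density hΦ, ← trace_traceAncillae_ketBra,
      show traceAncillae (ketBra Φ) = ρ from hpur, hρ.2]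
  have hhull := deFinettiState_mem_convexHull hint
  have hstate : IsState (deFinettiState Φ) :=
    convexHull_min (Set.range_subset_iff.mpr isState_tensorPow_localState) convex_isState hhull
  refine ⟨density_nonneg Φ, hint, hstate, ?_, ?_⟩
  · refine convexHull_mono (Set.range_subset_iff.mpr fun Ψ => ?_) hhull
    exact ⟨fun _ => localState Ψ, fun _ => isState_localState Ψ, rfl⟩
  · rintro k S rfl
    exact traceNorm_reduced_sub_le hρ hΦ hpur hstate S
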